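/- Let $G$ be a finite directed graph with vertex set $V$, and let $L\in\mathbb N$. A matching of a directed graph on $V$ is a set of pairwise vertex-disjoint directed cycles, each of length at most $L$; its cardinality is the number of vertices lying on its cycles. For every directed graph $H$ on $V$, fix a maximum cardinality matching of $H$ and let $\mathrm{opt}(H)$ be the set of vertices it matches. Suppose that $\mathrm{opt}(G)\neq\emptyset$. Let $(p_1,\dots,p_k)$ be a probability distribution on $k$ players. Every vertex of $G$ is assigned, independently, to a random owner, which is player $i$ with probability $p_i$. Let $H_i$ be the random subgraph of $G$ induced by the vertices owned by player $i$ (all other vertices may be regarded as isolated). Then for every $\delta>0$, with probability at least $1-\delta$, the following holds simultaneously for all $i\in\{1,\dots,k\}$: $$|\mathrm{opt}(H_i)| < \mathbb E\big[|\mathrm{opt}(H_i)|\big] + 2L\sqrt{|\mathrm{opt}(G)|\,\ln\frac{2k}{\delta}},$$ and, if $p_i>0$, $$\mathbb E\big[|\mathrm{opt}(H_i)|\big] - L\sqrt{2\,\mathbb E\big[|\mathrm{opt}(H_i)|\big]\,\ln\frac{2k}{\delta}} < |\mathrm{opt}(H_i)|.$$ (For $\delta\ge 1$ the assertion is trivially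 true, and where the logarithm is negative the square root is read as $0$.) -/

import Mathlib

open MeasureTheory

namespace KidneyExchange

/-- The subgraph of `G` induced by the vertex set `S`. The vertices outside `S` are kept as isolated
vertices without loops; they lie on no cycle. -/
def inducedSubgraph {V : Type*} (G : Digraph V) (S : Set V) : Digraph V where
  Adj u v := u ∈ S ∧ v ∈ S ∧ G.Adj u v

/-- A (simple) directed cycle of `G`: a nonempty cyclic sequence of distinct vertices in which every
vertex has an edge to the next one, and the last one to the first. A loop is a cycle of length one. -/
structure IsDirectedCycle {V : Type*} (G : Digraph V) (c : Cycle V) : Prop where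
  nonempty : c ≠ Cycle.nil
  nodup : c.Nodup
  chain : c.Chain G.Adj

/-- A matching of `G` restricted to cycles of length at most `L`: a set of pairwise vertex-disjoint
directed cycles of `G`, each of length at most `L`. -/
structure IsMatching {V : Type*} (L : ℕ) (G : Digraph V) (M : Finset (Cycle V)) : Prop where
  isCycle : ∀ c ∈ M, IsDirectedCycle G c
  length_le : ∀ c ∈ M, c.length ≤ L
  disjoint : ∀ c ∈ M, ∀ d ∈ M, c ≠ d → ∀ v, v ∈ c → v ∉ d

/-- The vertices matched by `M`. -/
def matchedVertices {V : Type*} [DecidableEq V] (M : Finset (Cycle V)) : Finset V :=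
  M.biUnion Cycle.toFinset

/-- `M` is a maximum cardinality matching of `G` with cycles of length at most `L`; the cardinality
of a matching is the number of vertices that it matches. -/
def IsMaximumMatching {V : Type*} [DecidableEq V] (L : ℕ) (G : Digraph V)
    (M : Finset (Cycle V)) : Prop :=
  IsMatching L G M ∧
    ∀ N : Finset (Cycle V), IsMatching L G N → (matchedVertices N).card ≤ (matchedVertices M).card

/-- `opt` selects, for every digraph on `V`, the set of vertices matched under some fixed maximum
cardinality matching with cycles of length at most `L`. -/
def IsOptSelection {V : Type*} [DecidableEq V] (L : ℕ) (opt : Digraph V → Finset V) : Prop :=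
  ∀ G : Digraph V, ∃ M : Finset (Cycle V), IsMaximumMatching L G M ∧ opt G = matchedVertices M

/-- Such a selection exists. -/
theorem exists_isOptSelection {V : Type*} [Fintype V] [DecidableEq V] (L : ℕ) :
    ∃ opt : Digraph V → Finset V, IsOptSelection L opt := by
  have key : ∀ G : Digraph V, ∃ M : Finset (Cycle V), IsMaximumMatching L G M := by
    intro G
    let s : Set ℕ := {m | ∃ M : Finset (Cycle V), IsMatching L G M ∧ (matchedVertices M).card = m}
    have hne : s.Nonempty := ⟨_, ∅, ⟨by simp, by simp, by simp⟩, rfl⟩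
    have hb : BddAbove s := by
      refine ⟨Fintype.card V, ?_⟩
      rintro m ⟨M, -, rfl⟩
      exact Finset.card_le_univ _
    obtain ⟨M, hM, hMs⟩ := Nat.sSup_mem hne hb
    refine ⟨M, hM, fun N hN => ?_⟩
    rw [hMs]
    exact le_csSup hb ⟨N, hN, rfl⟩
  choose M hM using key
  exact ⟨fun G => matchedVertices (M G), fun G => ⟨M G, hM G, rfl⟩⟩

/-- The law of the random assignment of owners: every vertex draws its owner independently from the
distribution `p` on the `k` players. -/
noncomputable def ownerLaw (V : Type*) [Fintype V] {k : ℕ} (p : PMF (Fin k)) :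
    Measure (V → Fin k) :=
  Measure.pi fun _ : V => p.toMeasure

/-- The subgraph `H_i` of player `i`: the subgraph of `G` induced by the vertices that `i` owns. -/
def playerSubgraph {V : Type*} {k : ℕ} (G : Digraph V) (owner : V → Fin k) (i : Fin k) :
    Digraph V :=
  inducedSubgraph G {v | owner v = i}

/-- The expected size of the optimal internal matching of player `i`. -/
noncomputable def expectedInternal {V : Type*} [Fintype V] {k : ℕ} (opt : Digraph V → Finset V)
    (G : Digraph V) (p : PMF (Fin k)) (i : Fin k) : ℝ :=
  ∫ owner, ((opt (playerSubgraph G owner i)).card : ℝ) ∂(ownerLaw V p)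

end KidneyExchange

namespace KidneyExchange

/-! Fix a player and let `f x` be the size of the optimal internal matching under the owner
assignment `x`, with `S x` its set of matched vertices. Passing from `x` to `y`, the cycles on which
no vertex changes owner still form a matching. By disjointness each changed vertex destroys at most
one cycle, hence at most `L` matched vertices. So `f x ≤ f y + L * #{v ∈ S x | x v ≠ y v}`, where
`#(S x) = f x ≤ #(opt G)`; this is `IsOptSelection.card_playerSubgraph_le_add`.

Plain bounded differences would put the number of all vertices under the root. Here the weights live
on `S x` only, and Talagrand-type exponential inequalities exploit this:
`productExpectation_exp_neg_le` and `productExpectation_exp_le`. They are proved by induction on the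
coordinates from a one-coordinate inequality. They involve two functions `f` and `g` because the
induction compares the slices at two different values of the new coordinate.

Chernoff's method then gives the tails. Bounding `#(S x)` by `#(opt G)` yields the upper one;
bounding it by `f x` puts the mean under the root in the lower one. A union bound over `2k` events
of probability at most `δ / (2k)` finishes. -/

/-- The expectation of `F` when every coordinate is drawn independently with weights `w`. -/
noncomputable def productExpectation {ι α : Type*} [Fintype ι] [DecidableEq ι] [Fintype α]
    (w : α → ℝ) (F : (ι → α) → ℝ) : ℝ :=
  ∑ x, (∏ i, w (x i)) * F x

/-! ### Expectations over finite product spaces -/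

section ProductExpectation

variable {ι α : Type*} [Fintype ι] [DecidableEq ι] [Fintype α] {w : α → ℝ}

theorem productExpectation_mono (hw : ∀ a, 0 ≤ w a) {F F' : (ι → α) → ℝ} (h : ∀ x, F x ≤ F' x) :
    productExpectation w F ≤ productExpectation w F' :=
  Finset.sum_le_sum fun x _ =>
    mul_le_mul_of_nonneg_left (h x) (Finset.prod_nonneg fun i _ => hw (x i))

theorem productExpectation_add (F F' : (ι → α) → ℝ) :
    productExpectation w (fun x => F x + F' x) =
      productExpectation w F + productExpectation w F' := by
  simp only [productExpectation, mul_add, Finset.sum_add_distrib]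

theorem productExpectation_sub (F F' : (ι → α) → ℝ) :
    productExpectation w (fun x => F x - F' x) =
      productExpectation w F - productExpectation w F' := by
  simp only [productExpectation, mul_sub, Finset.sum_sub_distrib]

theorem productExpectation_const_mul (c : ℝ) (F : (ι → α) → ℝ) :
    productExpectation w (fun x => c * F x) = c * productExpectation w F := by
  simp only [productExpectation, Finset.mul_sum, mul_left_comm]

theorem productExpectation_const (hw1 : ∑ a, w a = 1) (c : ℝ) :
    productExpectation w (fun _ : ι → α => c) = c := by
  simp only [productExpectation, ← Finset.sum_mul]
  rw [← Fintype.prod_sum (fun (_ : ι) a => w a)]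
  simp [hw1]

theorem productExpectation_congr_equiv {κ : Type*} [Fintype κ] [DecidableEq κ] (e : ι ≃ κ)
    (F : (κ → α) → ℝ) :
    productExpectation w F = productExpectation w (fun x : ι → α => F (x ∘ e.symm)) := by
  unfold productExpectation
  refine (Fintype.sum_equiv (e.arrowCongr (Equiv.refl α)) _ _ fun x => ?_).symm
  congr 1
  exact Fintype.prod_equiv e _ _ fun i => by simp

/-- The point of `Option ι → α` with value `a` at `none` and `x` elsewhere. -/
def optionCons (a : α) (x : ι → α) : Option ι → α := fun o => o.elim a x

/-- Conditioning on one coordinate, the inductive step of the exponential inequalities. The instance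
on `Option ι` is arbitrary so that it matches whichever one the induction supplies. -/
theorem productExpectation_option [DecidableEq (Option ι)] (F : (Option ι → α) → ℝ) :
    productExpectation w F =
      ∑ a, w a * productExpectation w (fun x : ι → α => F (optionCons a x)) := by
  unfold productExpectation
  simp only [Finset.mul_sum]
  rw [← Fintype.sum_prod_type']
  refine Fintype.sum_equiv Equiv.piOptionEquivProd _ _ fun x => ?_
  have : optionCons (x none) (fun i => x (some i)) = x := by
    ext o; cases o <;> rfl
  simp [Fintype.prod_option, Equiv.piOptionEquivProd, this, mul_assoc]

end ProductExpectation

/-! ### One-coordinate exponential inequalities -/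

theorem exp_neg_le_quadratic {x : ℝ} (hx : 0 ≤ x) : Real.exp (-x) ≤ 1 - x + x ^ 2 / 2 := by
  have h := Real.quadratic_le_exp_of_nonneg hx
  rw [Real.exp_neg, inv_le_iff_one_le_mul₀ (Real.exp_pos x)]
  have h0 : 0 ≤ 1 - x + x ^ 2 / 2 := by nlinarith [sq_nonneg (x - 1)]
  -- `(1 + x + x²/2)(1 - x + x²/2) = 1 + x⁴/4 ≥ 1`.
  nlinarith [mul_le_mul_of_nonneg_left h h0, sq_nonneg (x ^ 2)]

/-- The one-coordinate case of `productExpectation_exp_neg_le`. -/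
theorem sum_exp_neg_le {α : Type*} [Fintype α] [DecidableEq α] {w : α → ℝ} (hw : ∀ a, 0 ≤ w a)
    (hw1 : ∑ a, w a = 1) (A b d : α → ℝ) (hd : ∀ s, 0 ≤ d s)
    (h : ∀ s t, b s ≤ A t + if s ≠ t then d s else 0) :
    ∑ a, w a * Real.exp (-A a) ≤ Real.exp (-∑ a, w a * (b a - d a ^ 2 / 2)) := by
  have hne : Nonempty α := by
    by_contra hα
    rw [not_nonempty_iff] at hα
    simp at hw1
  -- Comparing with the minimiser `t` of `A` bounds `b s - A t` by both `A s - A t` and `d s`.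
  -- Truncating at the smaller of the two, `m`, keeps the quadratic error below `d s ^ 2 / 2`.
  -- Averaging and `1 + x ≤ exp x` conclude.
  obtain ⟨t, ht⟩ := Finite.exists_min A
  have key : ∀ s, b s - d s ^ 2 / 2 - A t ≤ 1 - Real.exp (-(A s - A t)) := by
    intro s
    have h1 : b s - A t ≤ A s - A t := by have := h s s; simp at this; linarith
    have h2 : b s - A t ≤ d s := by
      have := h s t
      split_ifs at this <;> linarith [hd s]
    have hs := ht s
    set m := min (A s - A t) (d s)
    have hm0 : 0 ≤ m := le_min (by linarith) (hd s)
    have hm : b s - A t ≤ m := le_min h1 h2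
    have h3 : Real.exp (-(A s - A t)) ≤ Real.exp (-m) :=
      Real.exp_le_exp.2 (neg_le_neg (min_le_left _ _))
    have h4 := exp_neg_le_quadratic hm0
    have h5 : m ^ 2 ≤ d s ^ 2 := pow_le_pow_left₀ hm0 (min_le_right _ _) 2
    linarith
  have hsum : ∑ a, w a * (b a - d a ^ 2 / 2 - A t) ≤
      1 - ∑ a, w a * Real.exp (-(A a - A t)) := by
    calc _ ≤ ∑ a, w a * (1 - Real.exp (-(A a - A t))) :=
          Finset.sum_le_sum fun a _ => mul_le_mul_of_nonneg_left (key a) (hw a)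
      _ = _ := by simp only [mul_sub, mul_one, Finset.sum_sub_distrib, hw1]
  have hsum' : ∑ a, w a * (b a - d a ^ 2 / 2 - A t) = (∑ a, w a * (b a - d a ^ 2 / 2)) - A t := by
    simp only [mul_sub, Finset.sum_sub_distrib, ← Finset.sum_mul, hw1, one_mul]
  have hfac : ∑ a, w a * Real.exp (-A a) =
      Real.exp (-A t) * ∑ a, w a * Real.exp (-(A a - A t)) := by
    rw [Finset.mul_sum]
    refine Finset.sum_congr rfl fun a _ => ?_
    rw [mul_left_comm, ← Real.exp_add]
    congr 2; ring
  rw [hfac]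
  set S := ∑ a, w a * (b a - d a ^ 2 / 2)
  have h6 : ∑ a, w a * Real.exp (-(A a - A t)) ≤ Real.exp (-(S - A t)) := by
    have := Real.add_one_le_exp (-(S - A t))
    linarith
  calc _ ≤ Real.exp (-A t) * Real.exp (-(S - A t)) :=
        mul_le_mul_of_nonneg_left h6 (Real.exp_pos _).le
    _ = _ := by rw [← Real.exp_add]; congr 1; ring

theorem exp_sub_sq_le {x : ℝ} (hx : 0 ≤ x) (hx1 : x ≤ 1 / 2) :
    Real.exp (x - x ^ 2) ≤ 1 + x := by
  have h := Real.one_sub_le_exp_neg (x - x ^ 2)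
  rw [Real.exp_neg] at h
  have hp := Real.exp_pos (x - x ^ 2)
  have h1 : (1 - (x - x ^ 2)) * Real.exp (x - x ^ 2) ≤ 1 := by
    calc _ ≤ (Real.exp (x - x ^ 2))⁻¹ * Real.exp (x - x ^ 2) :=
          mul_le_mul_of_nonneg_right h hp.le
      _ = 1 := inv_mul_cancel₀ hp.ne'
  -- `(1 + x)(1 - x + x²) = 1 + x³`.
  have h2 : 1 ≤ (1 + x) * (1 - (x - x ^ 2)) := by nlinarith [pow_nonneg hx 3]
  have h3 : 0 < 1 - (x - x ^ 2) := by nlinarith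
  nlinarith

/-- The one-coordinate case of `productExpectation_exp_le`. -/
theorem sum_exp_le {α : Type*} [Fintype α] {w : α → ℝ} (hw : ∀ a, 0 ≤ w a)
    (hw1 : ∑ a, w a = 1) (A B : α → ℝ)
    (h : ∀ s t, ∀ θ : ℝ, 0 ≤ θ → θ ≤ 1 →
      B s ≤ Real.exp (θ ^ 2 / 4 + (1 - θ) * A s + θ * A t)) :
    ∑ a, w a * B a ≤ Real.exp (∑ a, w a * A a) := by
  have hne : Nonempty α := by
    by_contra hα
    rw [not_nonempty_iff] at hα
    simp at hw1
  obtain ⟨t, ht⟩ := Finite.exists_min A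
  have key : ∀ s, B s ≤ Real.exp (A t) * (1 + (A s - A t)) := by
    intro s
    have hs := ht s
    -- With `u = A s - A t`, the exponent `θ²/4 + (1 - θ)u` is least at `θ = 2u`, with value `u -
    -- u²`. Once `2u` reaches `1`, the endpoint `θ = 1` suffices.
    rcases le_total (A s - A t) (1 / 2) with h1 | h1
    · refine (h s t (2 * (A s - A t)) (by linarith) (by linarith)).trans ?_
      refine le_trans (le_of_eq ?_) (mul_le_mul_of_nonneg_left
        (exp_sub_sq_le (x := A s - A t) (by linarith) h1) (Real.exp_pos (A t)).le)
      rw [← Real.exp_add]; congr 1; ring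
    · refine (h s t 1 (by norm_num) le_rfl).trans ?_
      have h2 := exp_sub_sq_le (x := 1 / 2) (by norm_num) le_rfl
      calc _ = Real.exp (A t) * Real.exp (1 / 2 - (1 / 2) ^ 2) := by
            rw [← Real.exp_add]; congr 1; ring
        _ ≤ _ := mul_le_mul_of_nonneg_left (by linarith) (Real.exp_pos _).le
  calc _ ≤ ∑ a, w a * (Real.exp (A t) * (1 + (A a - A t))) :=
        Finset.sum_le_sum fun a _ => mul_le_mul_of_nonneg_left (key a) (hw a)
    _ = Real.exp (A t) * ∑ a, (w a + (w a * A a - w a * A t)) := by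
        rw [Finset.mul_sum]; exact Finset.sum_congr rfl fun a _ => by ring
    _ = Real.exp (A t) * (((∑ a, w a * A a) - A t) + 1) := by
        simp only [Finset.sum_add_distrib, Finset.sum_sub_distrib, ← Finset.sum_mul, hw1]; ring
    _ ≤ Real.exp (A t) * Real.exp ((∑ a, w a * A a) - A t) :=
        mul_le_mul_of_nonneg_left (Real.add_one_le_exp _) (Real.exp_pos _).le
    _ = _ := by rw [← Real.exp_add]; congr 1; ring

/-! ### Transport inequalities by induction on the coordinates -/

/-- A lower-tail transport inequality on a product space: if `f` drops from `x` to `y` by at most the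
total weight `c i x` of the coordinates at which they differ, then the exponential moment of `-f` is
controlled by the mean of the squared weights. -/
theorem productExpectation_exp_neg_le {ι α : Type*} [Fintype ι] [hι : DecidableEq ι] [Fintype α]
    [DecidableEq α] {w : α → ℝ} (hw : ∀ a, 0 ≤ w a) (hw1 : ∑ a, w a = 1)
    (f g : (ι → α) → ℝ) (c : ι → (ι → α) → ℝ) (hc : ∀ i x, 0 ≤ c i x)
    (h : ∀ x y, g x ≤ f y + ∑ i, if x i ≠ y i then c i x else 0) :
    productExpectation w (fun x => Real.exp (-f x)) ≤
      Real.exp (-productExpectation w (fun x => g x - (∑ i, c i x ^ 2) / 2)) := by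
  suffices H : ∀ [DecidableEq ι], ∀ (f g : (ι → α) → ℝ) (c : ι → (ι → α) → ℝ),
      (∀ i x, 0 ≤ c i x) → (∀ x y, g x ≤ f y + ∑ i, if x i ≠ y i then c i x else 0) →
      productExpectation w (fun x => Real.exp (-f x)) ≤
        Real.exp (-productExpectation w (fun x => g x - (∑ i, c i x ^ 2) / 2)) from H f g c hc h
  clear hc h c f g
  clear hι
  refine Fintype.induction_empty_option (P := fun ι _ => ∀ [DecidableEq ι],
      ∀ (f g : (ι → α) → ℝ) (c : ι → (ι → α) → ℝ),
      (∀ i x, 0 ≤ c i x) → (∀ x y, g x ≤ f y + ∑ i, if x i ≠ y i then c i x else 0) →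
      productExpectation w (fun x => Real.exp (-f x)) ≤
        Real.exp (-productExpectation w (fun x => g x - (∑ i, c i x ^ 2) / 2))) ?_ ?_ ?_ ι
  · intro ι κ _ e ih _ f g c hc h
    let _ := Fintype.ofEquiv κ e.symm
    let _ := Classical.decEq ι
    rw [productExpectation_congr_equiv e (fun x => Real.exp (-f x)),
      productExpectation_congr_equiv e]
    have hsum : ∀ F : κ → ℝ, ∑ i, F i = ∑ i, F (e i) := fun F => (Equiv.sum_comp e F).symm
    have := ih (fun x => f (x ∘ e.symm)) (fun x => g (x ∘ e.symm))
      (fun i x => c (e i) (x ∘ e.symm)) (fun i x => hc _ _) (fun x y => by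
        have := h (x ∘ e.symm) (y ∘ e.symm)
        simpa only [hsum, Function.comp_apply, e.symm_apply_apply] using this)
    simpa only [hsum] using this
  · intro _ f g c hc h
    have hg : ∀ x, g x ≤ f x := fun x => by simpa using h x x
    simp only [productExpectation, Fintype.sum_unique, Finset.univ_eq_empty, Finset.prod_empty,
      Finset.sum_empty, one_mul, zero_div, sub_zero]
    exact Real.exp_le_exp.2 (neg_le_neg (hg _))
  · intro ι _ ih _ f g c hc h
    let _ := Classical.decEq ι
    have hpos : ∀ t, 0 < productExpectation w (fun x => Real.exp (-f (optionCons t x))) := by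
      intro t
      obtain ⟨m, hm⟩ : ∃ m : ℝ, ∀ x : ι → α, m ≤ -f (optionCons t x) := by
        obtain ⟨m, hm⟩ := (Set.finite_range fun x : ι → α => -f (optionCons t x)).bddBelow
        exact ⟨m, fun x => hm ⟨x, rfl⟩⟩
      calc 0 < Real.exp m := Real.exp_pos m
        _ = productExpectation w (fun _ : ι → α => Real.exp m) :=
            (productExpectation_const hw1 _).symm
        _ ≤ _ := productExpectation_mono hw fun x => Real.exp_le_exp.2 (hm x)
    set d : α → ℝ := fun s => productExpectation w (fun x => c none (optionCons s x)) with hd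
    have hd0 : ∀ s, 0 ≤ d s := fun s => by
      rw [← productExpectation_const (ι := ι) hw1 0]
      exact productExpectation_mono hw fun x => hc _ _
    -- The one-coordinate inequality is applied to the log-Laplace transforms of the slices of `f`,
    -- with `d s` the mean weight of the new coordinate.
    have hstep := sum_exp_neg_le hw hw1
      (fun t => -Real.log (productExpectation w (fun x => Real.exp (-f (optionCons t x)))))
      (fun s => productExpectation w (fun x =>
        g (optionCons s x) - (∑ i, c (some i) (optionCons s x) ^ 2) / 2)) d hd0 ?_
    · rw [productExpectation_option, productExpectation_option]
      simp only [neg_neg, Real.exp_log (hpos _)] at hstep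
      refine hstep.trans (Real.exp_le_exp.2 (neg_le_neg
        (Finset.sum_le_sum fun s _ => mul_le_mul_of_nonneg_left ?_ (hw s))))
      -- Jensen's inequality for the square, by averaging `2dc - d² ≤ c²`.
      have h1 : d s ^ 2 ≤ productExpectation w (fun x => c none (optionCons s x) ^ 2) := by
        have := productExpectation_mono hw (F := fun x : ι → α =>
            2 * d s * c none (optionCons s x) - d s ^ 2)
          (F' := fun x => c none (optionCons s x) ^ 2)
          (fun x => by nlinarith [sq_nonneg (c none (optionCons s x) - d s)])
        rw [productExpectation_sub, productExpectation_const_mul,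
          productExpectation_const hw1] at this
        change 2 * d s * d s - d s ^ 2 ≤ _ at this
        linarith
      have h2 : productExpectation w (fun x : ι → α =>
          g (optionCons s x) - (∑ i, c i (optionCons s x) ^ 2) / 2) =
          productExpectation w (fun x =>
            g (optionCons s x) - (∑ i, c (some i) (optionCons s x) ^ 2) / 2) -
          1 / 2 * productExpectation w (fun x => c none (optionCons s x) ^ 2) := by
        rw [← productExpectation_const_mul, ← productExpectation_sub]
        congr 1; ext x
        rw [Fintype.sum_option]; ring
      rw [h2]; linarith
    · intro s t
      -- The slice of `f` at `t` is compared with the slice of `g` at `s`; the cost of changing the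
      -- new coordinate is charged to `g`.
      have := ih (fun x => f (optionCons t x))
        (fun x => g (optionCons s x) - if s ≠ t then c none (optionCons s x) else 0)
        (fun i x => c (some i) (optionCons s x)) (fun i x => hc _ _) (fun x y => by
          have h1 : g (optionCons s x) ≤ f (optionCons t y) +
              ((if s ≠ t then c none (optionCons s x) else 0) +
                ∑ i, if x i ≠ y i then c (some i) (optionCons s x) else 0) := by
            have := h (optionCons s x) (optionCons t y)
            rwa [Fintype.sum_option] at this
          linarith)
      rw [← Real.log_le_iff_le_exp (hpos t)] at this
      have h3 : productExpectation w (fun x : ι → α =>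
          (g (optionCons s x) - if s ≠ t then c none (optionCons s x) else 0) -
            (∑ i, c (some i) (optionCons s x) ^ 2) / 2) =
          productExpectation w (fun x =>
            g (optionCons s x) - (∑ i, c (some i) (optionCons s x) ^ 2) / 2) -
          if s ≠ t then d s else 0 := by
        split_ifs
        · rw [hd, ← productExpectation_sub]
          congr 1; ext x; ring
        · simp
      rw [h3] at this
      linarith

/-- The upper-tail counterpart of `productExpectation_exp_neg_le`. -/
theorem productExpectation_exp_le {ι α : Type*} [Fintype ι] [hι : DecidableEq ι] [Fintype α]
    [DecidableEq α] {w : α → ℝ} (hw : ∀ a, 0 ≤ w a) (hw1 : ∑ a, w a = 1)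
    (f g : (ι → α) → ℝ) (c : ι → (ι → α) → ℝ) (hc : ∀ i x, 0 ≤ c i x)
    (h : ∀ x y, g x ≤ f y + ∑ i, if x i ≠ y i then c i x else 0) :
    productExpectation w (fun x => Real.exp (g x - ∑ i, c i x ^ 2)) ≤
      Real.exp (productExpectation w f) := by
  suffices H : ∀ [DecidableEq ι], ∀ (f g : (ι → α) → ℝ) (c : ι → (ι → α) → ℝ),
      (∀ i x, 0 ≤ c i x) → (∀ x y, g x ≤ f y + ∑ i, if x i ≠ y i then c i x else 0) →
      productExpectation w (fun x => Real.exp (g x - ∑ i, c i x ^ 2)) ≤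
        Real.exp (productExpectation w f) from H f g c hc h
  clear hc h c f g
  clear hι
  refine Fintype.induction_empty_option (P := fun ι _ => ∀ [DecidableEq ι],
      ∀ (f g : (ι → α) → ℝ) (c : ι → (ι → α) → ℝ),
      (∀ i x, 0 ≤ c i x) → (∀ x y, g x ≤ f y + ∑ i, if x i ≠ y i then c i x else 0) →
      productExpectation w (fun x => Real.exp (g x - ∑ i, c i x ^ 2)) ≤
        Real.exp (productExpectation w f)) ?_ ?_ ?_ ι
  · intro ι κ _ e ih _ f g c hc h
    let _ := Fintype.ofEquiv κ e.symm
    let _ := Classical.decEq ι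
    rw [productExpectation_congr_equiv e f, productExpectation_congr_equiv e]
    have hsum : ∀ F : κ → ℝ, ∑ i, F i = ∑ i, F (e i) := fun F => (Equiv.sum_comp e F).symm
    have := ih (fun x => f (x ∘ e.symm)) (fun x => g (x ∘ e.symm))
      (fun i x => c (e i) (x ∘ e.symm)) (fun i x => hc _ _) (fun x y => by
        have := h (x ∘ e.symm) (y ∘ e.symm)
        simpa only [hsum, Function.comp_apply, e.symm_apply_apply] using this)
    simpa only [hsum] using this
  · intro _ f g c hc h
    have hg : ∀ x, g x ≤ f x := fun x => by simpa using h x x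
    simp only [productExpectation, Fintype.sum_unique, Finset.univ_eq_empty, Finset.prod_empty,
      Finset.sum_empty, one_mul, sub_zero]
    exact Real.exp_le_exp.2 (hg _)
  · intro ι _ ih _ f g c hc h
    let _ := Classical.decEq ι
    rw [productExpectation_option, productExpectation_option]
    refine sum_exp_le hw hw1 (fun t => productExpectation w (fun x => f (optionCons t x))) _ ?_
    intro s t θ hθ hθ1
    -- The hypothesis with the new coordinate kept at `s` and the one with it moved to `t` are
    -- averaged with weights `1 - θ` and `θ`, so only a fraction `θ` of the weight is paid.
    have := ih (fun x => (1 - θ) * f (optionCons s x) + θ * f (optionCons t x))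
      (fun x => g (optionCons s x) - θ * c none (optionCons s x))
      (fun i x => c (some i) (optionCons s x)) (fun i x => hc _ _) (fun x y => by
        have h0 : ∀ r, g (optionCons s x) ≤ f (optionCons r y) +
            ((if s ≠ r then c none (optionCons s x) else 0) +
              ∑ i, if x i ≠ y i then c (some i) (optionCons s x) else 0) := by
          intro r
          have := h (optionCons s x) (optionCons r y)
          rwa [Fintype.sum_option] at this
        have h1 := h0 s
        have h2 := h0 t
        rw [if_neg (by simp)] at h1
        have h3 : (if s ≠ t then c none (optionCons s x) else 0) ≤ c none (optionCons s x) := by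
          split_ifs
          · exact le_rfl
          · exact hc _ _
        nlinarith [mul_le_mul_of_nonneg_left h3 hθ, mul_le_mul_of_nonneg_left h2 hθ,
          mul_le_mul_of_nonneg_left h1 (sub_nonneg.2 hθ1)])
    rw [productExpectation_add, productExpectation_const_mul, productExpectation_const_mul] at this
    -- The factor comes from `θ c - c² ≤ θ²/4`, where `c` is the weight of the new coordinate.
    calc _ ≤ productExpectation w (fun x : ι → α => Real.exp (θ ^ 2 / 4) *
          Real.exp (g (optionCons s x) - θ * c none (optionCons s x) -
            ∑ i, c (some i) (optionCons s x) ^ 2)) := by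
          refine productExpectation_mono hw fun x => ?_
          rw [← Real.exp_add, Fintype.sum_option]
          refine Real.exp_le_exp.2 ?_
          nlinarith [sq_nonneg (c none (optionCons s x) - θ / 2)]
      _ ≤ _ := by
          rw [productExpectation_const_mul, add_assoc, Real.exp_add]
          exact mul_le_mul_of_nonneg_left this (Real.exp_pos _).le

/-! ### Tail bounds by Chernoff's method -/

section Concentration

variable {ι α : Type*} [Fintype ι] [DecidableEq ι] [Fintype α] [DecidableEq α] {w : α → ℝ}

open Classical in
/-- Upper tail for functions that are `K`-Lipschitz on the coordinates of a certificate `S x` of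
at most `m` elements. -/
theorem productExpectation_upper_tail (hw : ∀ a, 0 ≤ w a) (hw1 : ∑ a, w a = 1)
    (f : (ι → α) → ℝ) (S : (ι → α) → Finset ι) {K m l : ℝ} (hK : 0 < K) (hm : 0 < m) (hl : 0 ≤ l)
    (hS : ∀ x, ((S x).card : ℝ) ≤ m)
    (h : ∀ x y, f x ≤ f y + K * ((S x).filter fun i => x i ≠ y i).card) :
    productExpectation w (fun x => if productExpectation w f + 2 * K * √(m * l) ≤ f x then 1 else 0)
      ≤ Real.exp (-l) := by
  set E := productExpectation w f with hE
  set r := √(m * l)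
  have hr : r ^ 2 = m * l := Real.sq_sqrt (by positivity)
  -- Minimiser of the Chernoff exponent `a²K²m - a(2Kr)`; the two terms become `l` and `2l`.
  set a := r / (K * m) with ha
  have ha0 : 0 ≤ a := by positivity
  have hmgf := productExpectation_exp_le hw hw1 (fun x => a * f x) (fun x => a * f x)
    (fun i x => if i ∈ S x then a * K else 0)
    (fun i x => by split_ifs <;> positivity) (fun x y => by
      have h1 := mul_le_mul_of_nonneg_left (h x y) ha0
      refine h1.trans_eq ?_
      rw [mul_add]
      congr 1
      rw [← Finset.sum_filter, ← Finset.sum_filter, Finset.sum_const, nsmul_eq_mul,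
        Finset.filter_filter]
      have : (Finset.univ.filter fun i => x i ≠ y i ∧ i ∈ S x) =
          (S x).filter fun i => x i ≠ y i := by ext; simp [and_comm]
      rw [this]; ring)
  rw [productExpectation_const_mul, ← hE] at hmgf
  have h2 : (a * K) ^ 2 * m = l := by
    rw [ha]; field_simp; rw [hr]
  have h3 : a * (2 * K * r) = 2 * l := by
    rw [ha]; field_simp; rw [hr]
  calc _ ≤ productExpectation w (fun x => Real.exp (-l - a * E) *
        Real.exp (a * f x - ∑ i, (if i ∈ S x then a * K else 0) ^ 2)) := by
        refine productExpectation_mono hw fun x => ?_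
        rw [← Real.exp_add]
        split_ifs with hx
        · rw [Real.one_le_exp_iff]
          have h4 : ∑ i, (if i ∈ S x then a * K else 0) ^ 2 = (a * K) ^ 2 * (S x).card := by
            simp [ite_pow, mul_comm]
          have h5 := mul_le_mul_of_nonneg_left hx ha0
          have h6 := mul_le_mul_of_nonneg_left (hS x) (sq_nonneg (a * K))
          rw [h4]
          linarith
        · exact (Real.exp_pos _).le
    _ ≤ Real.exp (-l - a * E) * Real.exp (a * E) := by
        rw [productExpectation_const_mul]
        exact mul_le_mul_of_nonneg_left hmgf (Real.exp_pos _).le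
    _ = _ := by rw [← Real.exp_add]; congr 1; ring

open Classical in
/-- Lower tail for functions that are `K`-Lipschitz on the coordinates of a certificate `S x` of
at most `f x` elements. -/
theorem productExpectation_lower_tail (hw : ∀ a, 0 ≤ w a) (hw1 : ∑ a, w a = 1)
    (f : (ι → α) → ℝ) (S : (ι → α) → Finset ι) {K l : ℝ} (hK : 0 < K) (hl : 0 ≤ l)
    (hE0 : 0 < productExpectation w f)
    (hS : ∀ x, ((S x).card : ℝ) ≤ f x)
    (h : ∀ x y, f x ≤ f y + K * ((S x).filter fun i => x i ≠ y i).card) :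
    productExpectation w
      (fun x => if f x ≤ productExpectation w f - K * √(2 * productExpectation w f * l)
        then 1 else 0) ≤ Real.exp (-l) := by
  set E := productExpectation w f with hE
  set r := √(2 * E * l)
  have hr : r ^ 2 = 2 * E * l := Real.sq_sqrt (by positivity)
  -- Minimiser of `a²K²E/2 - a(Kr)`; again the two terms are `l` and `2l`.
  set a := r / (K * E) with ha
  have ha0 : 0 ≤ a := by positivity
  have hmgf := productExpectation_exp_neg_le hw hw1 (fun x => a * f x) (fun x => a * f x)
    (fun i x => if i ∈ S x then a * K else 0)
    (fun i x => by split_ifs <;> positivity) (fun x y => by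
      have h1 := mul_le_mul_of_nonneg_left (h x y) ha0
      refine h1.trans_eq ?_
      rw [mul_add]
      congr 1
      rw [← Finset.sum_filter, ← Finset.sum_filter, Finset.sum_const, nsmul_eq_mul,
        Finset.filter_filter]
      have : (Finset.univ.filter fun i => x i ≠ y i ∧ i ∈ S x) =
          (S x).filter fun i => x i ≠ y i := by ext; simp [and_comm]
      rw [this]; ring)
  have h2 : (a * K) ^ 2 / 2 * E = l := by
    rw [ha]; field_simp; rw [hr]; ring
  have h3 : a * (K * r) = 2 * l := by
    rw [ha]; field_simp; rw [hr]; ring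
  -- Self-bounding: the penalty is at most `(aK)²/2 * f x`, whose mean is exactly `l`.
  have h7 : a * E - l ≤ productExpectation w
      (fun x => a * f x - (∑ i, (if i ∈ S x then a * K else 0) ^ 2) / 2) := by
    calc a * E - l = productExpectation w (fun x => a * f x - (a * K) ^ 2 / 2 * f x) := by
          rw [productExpectation_sub, productExpectation_const_mul, productExpectation_const_mul,
            ← hE, h2]
      _ ≤ _ := by
          refine productExpectation_mono hw fun x => ?_
          have h4 : ∑ i, (if i ∈ S x then a * K else 0) ^ 2 = (a * K) ^ 2 * (S x).card := by
            simp [ite_pow, mul_comm]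
          have h6 := mul_le_mul_of_nonneg_left (hS x) (sq_nonneg (a * K))
          rw [h4]
          linarith
  calc _ ≤ productExpectation w (fun x => Real.exp (a * E - 2 * l) * Real.exp (-(a * f x))) := by
        refine productExpectation_mono hw fun x => ?_
        rw [← Real.exp_add]
        split_ifs with hx
        · rw [Real.one_le_exp_iff]
          have h5 := mul_le_mul_of_nonneg_left hx ha0
          linarith
        · exact (Real.exp_pos _).le
    _ ≤ Real.exp (a * E - 2 * l) * Real.exp (-(a * E - l)) := by
        rw [productExpectation_const_mul]
        exact mul_le_mul_of_nonneg_left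
          (hmgf.trans (Real.exp_le_exp.2 (neg_le_neg h7))) (Real.exp_pos _).le
    _ = _ := by rw [← Real.exp_add]; congr 1; ring

end Concentration

/-! ### Cycles, matchings and the effect of reassigning owners -/

theorem cycle_chain_imp_of_mem {V : Type*} {r s : V → V → Prop} {c : Cycle V}
    (h : ∀ a ∈ c, ∀ b ∈ c, r a b → s a b) (hc : c.Chain r) : c.Chain s := by
  induction c using Cycle.induction_on with
  | nil => trivial
  | cons a l =>
    rw [Cycle.chain_coe_cons] at hc ⊢
    refine hc.imp_of_mem_imp fun x y hx hy => h x ?_ y ?_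
    · simpa [or_comm, or_assoc] using hx
    · simpa [or_comm, or_assoc] using hy

theorem card_cycle_toFinset_le {V : Type*} [DecidableEq V] (c : Cycle V) :
    c.toFinset.card ≤ c.length := by
  induction c using Cycle.induction_on with
  | nil => simp
  | cons a l =>
    rw [Cycle.coe_toFinset, Cycle.length_coe]
    exact List.toFinset_card_le _

theorem mem_cycle_toFinset {V : Type*} [DecidableEq V] {c : Cycle V} {v : V} :
    v ∈ c.toFinset ↔ v ∈ c := by
  induction c using Cycle.induction_on with
  | nil => simp
  | cons a l => rw [Cycle.coe_toFinset, List.mem_toFinset, Cycle.mem_coe_iff]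

theorem IsMatching.mono {V : Type*} {L : ℕ} {G H : Digraph V}
    (hGH : ∀ u v, G.Adj u v → H.Adj u v) {M : Finset (Cycle V)}
    (hM : IsMatching L G M) : IsMatching L H M where
  isCycle c hc := ⟨(hM.isCycle c hc).nonempty, (hM.isCycle c hc).nodup,
    (hM.isCycle c hc).chain.imp hGH⟩
  length_le := hM.length_le
  disjoint := hM.disjoint

section Matching

variable {V : Type*} [DecidableEq V] {L : ℕ} {G H : Digraph V} {opt : Digraph V → Finset V}

theorem mem_matchedVertices {M : Finset (Cycle V)} {v : V} :
    v ∈ matchedVertices M ↔ ∃ c ∈ M, v ∈ c := by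
  simp [matchedVertices, mem_cycle_toFinset]

theorem IsOptSelection.card_matchedVertices_le (hopt : IsOptSelection L opt)
    {M : Finset (Cycle V)} (hM : IsMatching L G M) :
    (matchedVertices M).card ≤ (opt G).card := by
  obtain ⟨N, hN, hGN⟩ := hopt G
  rw [hGN]
  exact hN.2 M hM

theorem IsOptSelection.card_mono (hopt : IsOptSelection L opt)
    (hGH : ∀ u v, G.Adj u v → H.Adj u v) : (opt G).card ≤ (opt H).card := by
  obtain ⟨M, hM, hGM⟩ := hopt G
  rw [hGM]
  exact hopt.card_matchedVertices_le (hM.1.mono hGH)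

/-- Supplies the positive Lipschitz constant by which the tail bounds divide. -/
theorem IsOptSelection.pos_of_nonempty (hopt : IsOptSelection L opt) (hG : (opt G).Nonempty) :
    0 < L := by
  obtain ⟨M, hM, hGM⟩ := hopt G
  rw [hGM] at hG
  obtain ⟨v, hv⟩ := hG
  obtain ⟨c, hc, hvc⟩ := mem_matchedVertices.1 hv
  have h1 : 0 < c.toFinset.card := Finset.card_pos.2 ⟨v, mem_cycle_toFinset.2 hvc⟩
  exact h1.trans_le ((card_cycle_toFinset_le c).trans (hM.1.length_le c hc))

theorem IsOptSelection.card_playerSubgraph_le (hopt : IsOptSelection L opt) {k : ℕ} (i : Fin k)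
    (x : V → Fin k) : (opt (playerSubgraph G x i)).card ≤ (opt G).card :=
  hopt.card_mono fun _ _ h => h.2.2

/-- Reassigning the owners of some vertices loses at most `L` matched vertices for each matched
vertex that changes its owner. -/
theorem IsOptSelection.card_playerSubgraph_le_add (hopt : IsOptSelection L opt) {k : ℕ}
    (i : Fin k) (x y : V → Fin k) :
    (opt (playerSubgraph G x i)).card ≤ (opt (playerSubgraph G y i)).card +
      L * ((opt (playerSubgraph G x i)).filter fun v => x v ≠ y v).card := by
  classical
  obtain ⟨M, ⟨hM, -⟩, hGM⟩ := hopt (playerSubgraph G x i)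
  rw [hGM]
  -- The cycles on which no owner changes survive in the subgraph for `y`.
  set N := M.filter fun c => ∀ v ∈ c, x v = y v
  have hN : IsMatching L (playerSubgraph G y i) N := by
    refine ⟨fun c hc => ?_, fun c hc => hM.length_le c (Finset.mem_filter.1 hc).1,
      fun c hc d hd => hM.disjoint c (Finset.mem_filter.1 hc).1 d (Finset.mem_filter.1 hd).1⟩
    obtain ⟨hcM, hxy⟩ := Finset.mem_filter.1 hc
    have h := hM.isCycle c hcM
    refine ⟨h.nonempty, h.nodup, cycle_chain_imp_of_mem (fun u hu v hv huv => ?_) h.chain⟩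
    obtain ⟨h1, h2, h3⟩ := huv
    exact ⟨(hxy u hu).symm.trans h1, (hxy v hv).symm.trans h2, h3⟩
  set B := (matchedVertices M).filter fun v => x v ≠ y v
  set D := M.filter fun c => ¬ ∀ v ∈ c, x v = y v
  have hD : ∀ c ∈ D, ∃ v, v ∈ c ∧ x v ≠ y v := fun c hc => by
    simpa using (Finset.mem_filter.1 hc).2
  -- Each destroyed cycle contains a matched vertex whose owner changed, and disjoint cycles cannot
  -- share it.
  have hDB : D.card ≤ B.card := by
    refine Finset.card_le_card_of_forall_subsingleton (fun c v => v ∈ c) (fun c hc => ?_)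
      fun v _ c hc d hd => ?_
    · obtain ⟨v, hvc, hxy⟩ := hD c hc
      exact ⟨v, Finset.mem_filter.2 ⟨mem_matchedVertices.2
        ⟨c, (Finset.mem_filter.1 hc).1, hvc⟩, hxy⟩, hvc⟩
    · by_contra hne
      exact hM.disjoint c (Finset.mem_filter.1 hc.1).1 d (Finset.mem_filter.1 hd.1).1 hne v
        hc.2 hd.2
  have hsub : matchedVertices M ⊆ matchedVertices N ∪ D.biUnion Cycle.toFinset := by
    intro v hv
    obtain ⟨c, hc, hvc⟩ := mem_matchedVertices.1 hv
    rw [Finset.mem_union]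
    by_cases hxy : ∀ v ∈ c, x v = y v
    · exact Or.inl (mem_matchedVertices.2 ⟨c, Finset.mem_filter.2 ⟨hc, hxy⟩, hvc⟩)
    · exact Or.inr (Finset.mem_biUnion.2
        ⟨c, Finset.mem_filter.2 ⟨hc, hxy⟩, mem_cycle_toFinset.2 hvc⟩)
  have hDL : (D.biUnion Cycle.toFinset).card ≤ D.card * L :=
    Finset.card_biUnion_le_card_mul _ _ _ fun c hc =>
      (card_cycle_toFinset_le c).trans (hM.length_le c (Finset.mem_filter.1 hc).1)
  calc _ ≤ _ := Finset.card_le_card hsub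
    _ ≤ _ := Finset.card_union_le _ _
    _ ≤ _ := by
      refine Nat.add_le_add (hopt.card_matchedVertices_le hN) ?_
      calc _ ≤ D.card * L := hDL
        _ ≤ B.card * L := Nat.mul_le_mul_right _ hDB
        _ = _ := Nat.mul_comm _ _

end Matching

/-! ### The law of the owners as a weighted finite sum -/

section OwnerLaw

variable {V : Type*} [Fintype V] [DecidableEq V] {k : ℕ} (p : PMF (Fin k))

theorem sum_toReal_pmf : ∑ a, (p a).toReal = 1 := by
  rw [← ENNReal.toReal_sum fun a _ => p.apply_ne_top a, ← tsum_fintype (L := .unconditional _),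
    p.tsum_coe, ENNReal.toReal_one]

instance isProbabilityMeasure_ownerLaw : IsProbabilityMeasure (ownerLaw V p) := by
  unfold ownerLaw; infer_instance

theorem integral_ownerLaw (F : (V → Fin k) → ℝ) :
    ∫ x, F x ∂(ownerLaw V p) = productExpectation (fun a => (p a).toReal) F := by
  rw [integral_fintype Integrable.of_finite]
  refine Finset.sum_congr rfl fun x _ => ?_
  rw [smul_eq_mul, Measure.real, ownerLaw, Measure.pi_singleton, ENNReal.toReal_prod]
  simp

theorem ownerLaw_real_setOf (P : (V → Fin k) → Prop) [DecidablePred P] :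
    (ownerLaw V p).real {x | P x} =
      productExpectation (fun a => (p a).toReal) (fun x => if P x then 1 else 0) := by
  rw [← integral_ownerLaw, ← integral_indicator_one (Set.toFinite _).measurableSet]
  simp [Set.indicator_apply]

/-- With positive probability player `i` owns every vertex, and then the subgraph is `G` itself. The
lower tail needs this because its parameter is divided by the mean. -/
theorem expectedInternal_pos {opt : Digraph V → Finset V} {G : Digraph V}
    (hG : (opt G).Nonempty) {i : Fin k} (hi : p i ≠ 0) :
    0 < expectedInternal opt G p i := by
  rw [expectedInternal, integral_ownerLaw]
  have hw : 0 < (p i).toReal := ENNReal.toReal_pos hi (p.apply_ne_top i)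
  have hH : playerSubgraph G (fun _ => i) i = G := by
    ext u v; simp [playerSubgraph, inducedSubgraph]
  refine lt_of_lt_of_le ?_ (Finset.single_le_sum (f := fun x : V → Fin k =>
    (∏ v, (p (x v)).toReal) * ((opt (playerSubgraph G x i)).card : ℝ))
    (fun x _ => by positivity) (Finset.mem_univ fun _ => i))
  rw [hH]
  have := hG.card_pos
  positivity

end OwnerLaw

end KidneyExchange

/-! ### Union bound over players and tails -/

theorem mainTheorem3 {V : Type*} [Fintype V] [DecidableEq V] (G : Digraph V) (L : ℕ)
    (opt : Digraph V → Finset V) (hopt : KidneyExchange.IsOptSelection L opt)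
    (hG : (opt G).Nonempty) (k : ℕ) (p : PMF (Fin k)) (δ : ℝ) (hδ : 0 < δ) :
    1 - δ ≤ (KidneyExchange.ownerLaw V p).real {owner : V → Fin k | ∀ i : Fin k,
      (p i ≠ 0 →
        KidneyExchange.expectedInternal opt G p i
            - L * √(2 * KidneyExchange.expectedInternal opt G p i * Real.log (2 * k / δ))
          < ((opt (KidneyExchange.playerSubgraph G owner i)).card : ℝ)) ∧
      ((opt (KidneyExchange.playerSubgraph G owner i)).card : ℝ)
        < KidneyExchange.expectedInternal opt G p i
            + 2 * L * √(((opt G).card : ℝ) * Real.log (2 * k / δ))} := by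
  open KidneyExchange in
  classical
  rcases le_or_gt 1 δ with hδ1 | hδ1
  · exact (sub_nonpos.2 hδ1).trans measureReal_nonneg
  have hk : 0 < k := Fin.pos p.support_nonempty.choose
  have hk1 : (1 : ℝ) ≤ k := by exact_mod_cast hk
  have hL : (0 : ℝ) < L := by exact_mod_cast hopt.pos_of_nonempty hG
  have hm : (0 : ℝ) < (opt G).card := by exact_mod_cast hG.card_pos
  set l := Real.log (2 * k / δ) with hl
  have hl0 : 0 ≤ l := Real.log_nonneg (by rw [le_div_iff₀ hδ]; linarith)
  have hexp : Real.exp (-l) = δ / (2 * k) := by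
    rw [Real.exp_neg, hl, Real.exp_log (by positivity), inv_div]
  set f : Fin k → (V → Fin k) → ℝ := fun i x => ((opt (playerSubgraph G x i)).card : ℝ)
  have hw : ∀ a, 0 ≤ (p a).toReal := fun a => ENNReal.toReal_nonneg
  have hw1 := sum_toReal_pmf p
  have hLip : ∀ i x y, f i x ≤ f i y +
      L * ((opt (playerSubgraph G x i)).filter fun v => x v ≠ y v).card := fun i x y => by
    have := hopt.card_playerSubgraph_le_add (G := G) i x y
    rw [← Nat.cast_mul, ← Nat.cast_add]
    exact Nat.cast_le.2 this
  have hE : ∀ i, expectedInternal opt G p i =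
      productExpectation (fun a => (p a).toReal) (f i) := fun i => integral_ownerLaw p _
  -- The lower event carries `p i ≠ 0`: for `p i = 0` the mean and the matching size vanish almost
  -- surely, so the strict lower bound would fail.
  set bad : Fin k → Set (V → Fin k) := fun i =>
    {x | p i ≠ 0 ∧ f i x ≤ expectedInternal opt G p i
        - L * √(2 * expectedInternal opt G p i * l)} ∪
    {x | expectedInternal opt G p i + 2 * L * √((opt G).card * l) ≤ f i x}
  have hbad : ∀ i, (ownerLaw V p).real (bad i) ≤ δ / k := by
    intro i
    have hup : (ownerLaw V p).real
        {x | expectedInternal opt G p i + 2 * L * √((opt G).card * l) ≤ f i x} ≤ δ / (2 * k) := by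
      rw [ownerLaw_real_setOf, ← hexp, hE]
      refine le_trans (le_of_eq ?_) (productExpectation_upper_tail hw hw1 (f i)
        (fun x => opt (playerSubgraph G x i)) hL hm hl0
        (fun x => by exact_mod_cast hopt.card_playerSubgraph_le i x)
        (fun x y => by convert! hLip i x y))
      rfl
    have hlow : (ownerLaw V p).real {x | p i ≠ 0 ∧ f i x ≤ expectedInternal opt G p i
        - L * √(2 * expectedInternal opt G p i * l)} ≤ δ / (2 * k) := by
      by_cases hi : p i = 0
      · simp only [hi, ne_eq, not_true_eq_false, false_and, Set.ofPred_false, measureReal_empty]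
        positivity
      · have hpos := expectedInternal_pos p hG hi
        simp only [ne_eq, hi, not_false_eq_true, true_and]
        rw [ownerLaw_real_setOf, ← hexp]
        rw [hE] at hpos ⊢
        exact productExpectation_lower_tail hw hw1 (f i)
          (fun x => opt (playerSubgraph G x i)) hL hl0 hpos (fun x => le_rfl)
          (fun x y => by convert! hLip i x y)
    calc _ ≤ _ := measureReal_union_le _ _
      _ ≤ δ / (2 * k) + δ / (2 * k) := add_le_add hlow hup
      _ = δ / k := by field_simp; ring
  have hunion : (ownerLaw V p).real (⋃ i ∈ Finset.univ, bad i) ≤ δ := by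
    calc _ ≤ ∑ i, (ownerLaw V p).real (bad i) := measureReal_biUnion_finset_le _ _
      _ ≤ ∑ _i : Fin k, δ / k := Finset.sum_le_sum fun i _ => hbad i
      _ = δ := by simp; field_simp
  have hcompl := probReal_compl_eq_one_sub (μ := ownerLaw V p)
    (s := ⋃ i ∈ Finset.univ, bad i) (Set.toFinite _).measurableSet
  calc 1 - δ ≤ (ownerLaw V p).real (⋃ i ∈ Finset.univ, bad i)ᶜ := by rw [hcompl]; linarith
    _ ≤ _ := by
      refine measureReal_mono fun x hx i => ?_
      have hxi : x ∉ bad i := fun h => hx (Set.mem_biUnion (Finset.mem_coe.2 (Finset.mem_univ i)) h)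
      refine ⟨fun hi => ?_, ?_⟩
      · by_contra h
        exact hxi (Or.inl ⟨hi, not_lt.1 h⟩)
      · by_contra h
        exact hxi (Or.inr (not_lt.1 h))
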